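/- Let $V$ be a finite-dimensional real vector space of even dimension with a non-degenerate symmetric bilinear form $\eta$, and let $C(V,\eta)$ be its real Clifford algebra, i.e. the quotient of the tensor algebra of $V$ by the two-sided ideal generated by the elements $v\otimes w+w\otimes v-2\eta(v,w)\,1$, $v,w\in V$. Write $C(V,\eta)^\times$ for its group of invertible elements and $\mathrm{Aut}[C(V,\eta)]$ for its group of ring automorphisms. Then the following hold. (1) Every ring automorphism of $C(V,\eta)$ is inner, i.e. of the form $q\mapsto gqg^{-1}$ for some $g\in C(V,\eta)^\times$. (2) $C(V,\eta)$ is isomorphic, as a real algebra, to a matrix algebra $\mathrm{Mat}(m,\mathcal K)$ for some $m$ and some $\mathcal K\in\{\mathbb R,\mathbb H\}$. (3) Let $\mathcal K\in\{\mathbb R,\mathbb C,\mathbb H\}$, and put $\mathcal Z=\mathbb R$ if $\mathcal K=\mathbb R$ or $\mathbb H$, and $\mathcal Z=\mathbb C$ if $\mathcal K=\mathbb C$. Let $\varphi:C(V,\eta)\to\mathrm{Mat}(m,\mathcal K)$ be any ring isomorphism. Then $\varphi$ restricts to a group isomorphism $C(V,\eta)^\times\cong GL(m,\mathcal K)$,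 and under this identification the adjoint representation $g\mapsto(q\mapsto gqg^{-1})$ induces a group isomorphism $$PGL(m,\mathcal K)=GL(m,\mathcal K)/\mathcal Z\;\cong\;\mathrm{Aut}[C(V,\eta)],$$ where the quotient is by the subgroup of the scalar matrices $z\mathbf 1$ with $0\ne z\in\mathcal Z$. (The case $\mathcal K=\mathbb C$ does not actually occur for even-dimensional $V$; it is listed for uniformity.) -/

import Mathlib

open scoped Quaternion

/-- The real Clifford algebra of a real vector space `V` with a symmetric bilinear form `η`,
i.e. the tensor algebra modulo the relations `v ⊗ v = η(v, v)`. For symmetric `η` these are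
equivalent to `v ⊗ w + w ⊗ v = 2 η(v, w)`, see `RealClifford.ι_mul_ι_add_swap`. -/
abbrev RealClifford {V : Type*} [AddCommGroup V] [Module ℝ V] (η : LinearMap.BilinForm ℝ V) :
    Type _ :=
  CliffordAlgebra (LinearMap.BilinMap.toQuadraticMap η)

/-- The defining relation `v w + w v = 2 η(v, w) e`. -/
theorem RealClifford.ι_mul_ι_add_swap {V : Type*} [AddCommGroup V] [Module ℝ V]
    (η : LinearMap.BilinForm ℝ V) (hη : η.IsSymm) (v w : V) :
    CliffordAlgebra.ι (LinearMap.BilinMap.toQuadraticMap η) v *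
        CliffordAlgebra.ι (LinearMap.BilinMap.toQuadraticMap η) w +
      CliffordAlgebra.ι (LinearMap.BilinMap.toQuadraticMap η) w *
        CliffordAlgebra.ι (LinearMap.BilinMap.toQuadraticMap η) v =
      algebraMap ℝ (RealClifford η) (2 * η v w) := by
  rw [CliffordAlgebra.ι_mul_ι_add_swap, LinearMap.BilinMap.polar_toQuadraticMap]
  have h : η w v = η v w := hη.eq w v
  rw [h, two_mul]

/-- `GL(m, K)`: the group of invertible `m × m` matrices over a ring `K` which need not be
commutative. -/
abbrev GLMat (m : ℕ) (K : Type*) [Ring K] : Type _ := (Matrix (Fin m) (Fin m) K)ˣ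

/-- The subgroup of `GL(m, K)` of the scalar matrices `z • 1`, `z` an invertible element of `Z`. -/
def scalarGL (Z : Type*) [CommRing Z] (m : ℕ) (K : Type*) [Ring K] [Algebra Z K] :
    Subgroup (GLMat m K) :=
  (Units.map (algebraMap Z (Matrix (Fin m) (Fin m) K)).toMonoidHom).range

instance scalarGL_normal (Z : Type*) [CommRing Z] (m : ℕ) (K : Type*) [Ring K] [Algebra Z K] :
    (scalarGL Z m K).Normal := by
  constructor
  rintro _ ⟨z, rfl⟩ g
  refine ⟨z, ?_⟩
  rw [eq_mul_inv_iff_mul_eq]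
  ext1
  exact Algebra.commutes (z : Z) (g : Matrix (Fin m) (Fin m) K)

/-- The projective linear group `PGL(m, K) = GL(m, K) / Z`. -/
abbrev PGLMat (Z : Type*) [CommRing Z] (m : ℕ) (K : Type*) [Ring K] [Algebra Z K] : Type _ :=
  GLMat m K ⧸ scalarGL Z m K

/-- For every identification `φ` of the ring `A` with a matrix ring `Mat(m, K)`, the map `φ`
restricts to a group isomorphism `e` from the invertible elements of `A` onto `GL(m, K)`, and the
adjoint representation `u ↦ (q ↦ u q u⁻¹)` induces a group isomorphism `f` from `GL(m, K) / Z` onto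
the group of ring automorphisms of `A`. -/
def UnitsAndAutAreLinear (A : Type*) [Ring A] (Z : Type*) [CommRing Z]
    (K : Type*) [Ring K] [Algebra Z K] : Prop :=
  ∀ (m : ℕ) (φ : A ≃+* Matrix (Fin m) (Fin m) K),
    ∃ (e : Aˣ ≃* GLMat m K) (f : PGLMat Z m K ≃* RingAut A),
      (∀ u : Aˣ, (e u : Matrix (Fin m) (Fin m) K) = φ (u : A)) ∧
      ∀ (u : Aˣ) (q : A), f (QuotientGroup.mk (e u)) q = (u : A) * q * ((u⁻¹ : Aˣ) : A)

/-! Take orthogonal vectors `i`, `j` with squares a, b = ±1. Multiplying the remaining vectors by k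
= ij makes them commute with `i` and `j`, at the cost of scaling their form by c = -ab. So the
Clifford algebra is a quaternion algebra tensored with a Clifford algebra in dimension two less
(`CliffordAlgebra.prodEquivTensor`). Sylvester's normal form and induction leave a tensor product of
copies of Mat(2, ℝ) and ℍ, and ℍ ⊗ ℍ ≅ Mat(4, ℝ) yields (2).

Such algebras are central simple over ℝ. A ring automorphism preserves the centre ℝ, whose only ring
endomorphism is the identity, so it is ℝ-linear and Skolem–Noether (`AlgEquiv.exists_units_conj`)
makes it inner. Innerness is intrinsic to the ring: for any identification with Mat(m, K), where K
has centre Z, the adjoint map is onto with kernel the central units, i.e. the scalars from Z. The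
first isomorphism theorem then gives (3). -/

open scoped TensorProduct

/-! ### Central simple algebras and Skolem–Noether -/

section CentralSimple

variable {k A : Type*} [Field k] [Ring A] [Algebra k A]

/-- In a central simple algebra, a vanishing sum of two-sided multiplications `x ↦ ∑ aᵢ x bᵢ` with
linearly independent right factors has vanishing left factors. -/
theorem Algebra.IsCentral.eq_zero_of_sum_mul_mul_eq_zero [Algebra.IsCentral k A] [IsSimpleRing A]
    {ι : Type*} {b : ι → A} (hb : LinearIndependent k b) (s : Finset ι) (a : ι → A)
    (h : ∀ x, ∑ i ∈ s, a i * x * b i = 0) : ∀ i ∈ s, a i = 0 := by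
  classical
  induction s using Finset.induction_on generalizing a with
  | empty => simp
  | insert j s hj ih =>
    suffices haj : a j = 0 by
      simp only [Finset.sum_insert hj, haj, zero_mul, zero_add] at h
      intro i hi
      rcases Finset.mem_insert.1 hi with rfl | hi
      exacts [haj, ih a h i hi]
    by_contra haj
    -- The possible `j`-th coefficients of such relations form a two-sided ideal; by simplicity some
    -- relation has `j`-th coefficient 1.
    let I : TwoSidedIdeal A := TwoSidedIdeal.mk'
      {c | ∃ a' : ι → A, a' j = c ∧ ∀ x, ∑ i ∈ insert j s, a' i * x * b i = 0}
      ⟨0, rfl, by simp⟩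
      (by
        rintro _ _ ⟨f, rfl, hf⟩ ⟨g, rfl, hg⟩
        exact ⟨f + g, rfl, fun x ↦ by simp [add_mul, Finset.sum_add_distrib, hf, hg]⟩)
      (by
        rintro _ ⟨f, rfl, hf⟩
        exact ⟨-f, rfl, fun x ↦ by simp [hf]⟩)
      (by
        rintro y _ ⟨f, rfl, hf⟩
        refine ⟨fun i ↦ y * f i, rfl, fun x ↦ ?_⟩
        simp only [mul_assoc y, ← Finset.mul_sum, hf, mul_zero])
      (by
        rintro _ y ⟨f, rfl, hf⟩
        refine ⟨fun i ↦ f i * y, rfl, fun x ↦ ?_⟩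
        simpa only [mul_assoc] using hf (y * x))
    have hI : (1 : A) ∈ I :=
      IsSimpleRing.one_mem_of_ne_zero_mem I haj ((TwoSidedIdeal.mem_mk' ..).2 ⟨a, rfl, h⟩)
    obtain ⟨f, hfj, hf⟩ := (TwoSidedIdeal.mem_mk' ..).1 hI
    -- Subtracting the relation at `y * x` from `y` times the relation at `x` cancels the `j`-th
    -- term, so induction makes every coefficient central.
    have hcomm : ∀ y, ∀ i ∈ s, y * f i - f i * y = 0 := fun y ↦ by
      refine ih (fun i ↦ y * f i - f i * y) fun x ↦ ?_
      have h1 := congrArg (y * ·) (hf x)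
      have h2 := hf (y * x)
      simp only [Finset.sum_insert hj, hfj, mul_add, Finset.mul_sum] at h1 h2
      simp only [sub_mul, Finset.sum_sub_distrib, mul_assoc] at h1 h2 ⊢
      simp only [one_mul, mul_zero] at h1 h2
      rw [← add_sub_add_left_eq_sub, h1, h2, sub_zero]
    have hscalar : ∀ i ∈ insert j s, ∃ r : k, algebraMap k A r = f i := fun i hi ↦ by
      rcases Finset.mem_insert.1 hi with rfl | hi
      · exact ⟨1, by simp [hfj]⟩
      · exact (Algebra.IsCentral.mem_center_iff k).1
          (Subalgebra.mem_center_iff.2 fun y ↦ sub_eq_zero.1 (hcomm y i hi)) |>.imp fun _ ↦ Eq.symm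
    choose! r hr using hscalar
    have h0 : ∑ i ∈ insert j s, r i • b i = 0 := by
      rw [← hf 1]
      exact Finset.sum_congr rfl fun i hi ↦ by rw [← hr i hi, mul_one, Algebra.smul_def]
    have hrj := linearIndependent_iff'.1 hb _ _ h0 j (Finset.mem_insert_self j s)
    have := hr j (Finset.mem_insert_self j s)
    rw [hrj, map_zero, hfj] at this
    exact zero_ne_one this

variable [FiniteDimensional k A]

/-- A finite-dimensional central simple algebra is an Azumaya algebra. -/
theorem IsAzumaya.of_isSimpleRing (k A : Type*) [Field k] [Ring A] [Algebra k A]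
    [FiniteDimensional k A] [Algebra.IsCentral k A] [IsSimpleRing A] : IsAzumaya k A where
  eq_of_smul_eq_smul := FaithfulSMul.eq_of_smul_eq_smul
  bij := by
    have hinj : Function.Injective (AlgHom.mulLeftRight k A).toLinearMap := by
      rw [← LinearMap.ker_eq_bot, LinearMap.ker_eq_bot']
      intro t ht
      let b := Module.finBasis k A
      let b' := b.map (MulOpposite.opLinearEquiv k)
      obtain ⟨a, rfl⟩ := (TensorProduct.equivFinsuppOfBasisRight (M := A) b').symm.surjective t
      have ha : a = 0 := by
        ext i
        refine Algebra.IsCentral.eq_zero_of_sum_mul_mul_eq_zero b.linearIndependent Finset.univ a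
          (fun x ↦ ?_) i (Finset.mem_univ i)
        have := LinearMap.congr_fun ht x
        simpa [TensorProduct.equivFinsuppOfBasisRight_symm_apply, Finsupp.sum_fintype, b']
          using this
      rw [ha, map_zero]
    refine ⟨hinj, (LinearMap.injective_iff_surjective_of_finrank_eq_finrank ?_).1 hinj⟩
    rw [Module.finrank_tensorProduct, Module.finrank_linearMap,
      (MulOpposite.opLinearEquiv k : A ≃ₗ[k] Aᵐᵒᵖ).finrank_eq]

/-- The **Skolem–Noether theorem** for automorphisms. -/
theorem AlgEquiv.exists_units_conj [Algebra.IsCentral k A] [IsSimpleRing A] (σ : A ≃ₐ[k] A) :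
    ∃ g : Aˣ, ∀ q, σ q = g * q * (g⁻¹ : Aˣ) := by
  have := IsAzumaya.of_isSimpleRing k A
  let b := Module.finBasis k A
  let b' := b.map (MulOpposite.opLinearEquiv k)
  obtain ⟨t, ht⟩ := (IsAzumaya.bij (R := k) (A := A)).2 σ.toLinearMap
  obtain ⟨a, rfl⟩ := (TensorProduct.equivFinsuppOfBasisRight (M := A) b').symm.surjective t
  have hσ : ∀ x, σ x = ∑ i, a i * x * b i := fun x ↦ by
    have := LinearMap.congr_fun ht x
    simpa [TensorProduct.equivFinsuppOfBasisRight_symm_apply, Finsupp.sum_fintype, b']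
      using this.symm
  -- Compare coefficients in σ(yx) = σ(y)σ(x).
  have hcomm : ∀ y i, a i * y = σ y * a i := fun y i ↦ by
    refine sub_eq_zero.1 <| Algebra.IsCentral.eq_zero_of_sum_mul_mul_eq_zero b.linearIndependent
      Finset.univ (fun i ↦ a i * y - σ y * a i) (fun x ↦ ?_) i (Finset.mem_univ i)
    have h1 := map_mul σ y x
    rw [hσ (y * x), hσ x, Finset.mul_sum] at h1
    simpa only [sub_mul, Finset.sum_sub_distrib, sub_eq_zero, mul_assoc] using h1
  obtain ⟨i, hi⟩ : ∃ i, a i ≠ 0 := by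
    by_contra! h0
    have := hσ 1
    simp [h0] at this
  -- The right ideal generated by `a i` is two-sided by `hcomm`, hence everything, so `a i` is right
  -- invertible.
  let I : TwoSidedIdeal A := TwoSidedIdeal.mk' {c | ∃ z, c = a i * z} ⟨0, by simp⟩
    (by rintro _ _ ⟨y, rfl⟩ ⟨z, rfl⟩; exact ⟨y + z, (mul_add ..).symm⟩)
    (by rintro _ ⟨z, rfl⟩; exact ⟨-z, (mul_neg ..).symm⟩)
    (by
      rintro y _ ⟨z, rfl⟩
      exact ⟨σ.symm y * z, by rw [← mul_assoc, ← mul_assoc, hcomm, σ.apply_symm_apply]⟩)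
    (by rintro _ y ⟨z, rfl⟩; exact ⟨z * y, mul_assoc ..⟩)
  have hI : (1 : A) ∈ I :=
    IsSimpleRing.one_mem_of_ne_zero_mem I hi ((TwoSidedIdeal.mem_mk' ..).2 ⟨1, (mul_one _).symm⟩)
  obtain ⟨z, hz⟩ := (TwoSidedIdeal.mem_mk' ..).1 hI
  have := IsNoetherianRing.of_finite k A
  let g : Aˣ := ⟨a i, z, hz.symm, mul_eq_one_symm hz.symm⟩
  exact ⟨g, fun q ↦ (Units.eq_mul_inv_iff_mul_eq g).2 (hcomm q i).symm⟩

/-- Every ring automorphism of a finite-dimensional central simple real algebra is inner. -/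
theorem RingAut.exists_units_conj_of_isCentral_real {A : Type*} [Ring A] [Algebra ℝ A]
    [FiniteDimensional ℝ A] [Algebra.IsCentral ℝ A] [IsSimpleRing A] (σ : RingAut A) :
    ∃ g : Aˣ, ∀ q, σ q = g * q * (g⁻¹ : Aˣ) := by
  have hσ : ∀ r : ℝ, ∃ r' : ℝ, algebraMap ℝ A r' = σ (algebraMap ℝ A r) := fun r ↦ by
    refine ((Algebra.IsCentral.mem_center_iff ℝ).1 (Subalgebra.mem_center_iff.2 fun y ↦ ?_)).imp
      fun _ ↦ Eq.symm
    obtain ⟨y, rfl⟩ := σ.surjective y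
    rw [← map_mul, ← map_mul, Algebra.commutes]
  choose f hf using hσ
  have hinj := FaithfulSMul.algebraMap_injective ℝ A
  let F : ℝ →+* ℝ :=
    { toFun := f
      map_one' := hinj (by simp [hf])
      map_mul' := fun x y ↦ hinj (by simp [hf])
      map_zero' := hinj (by simp [hf])
      map_add' := fun x y ↦ hinj (by simp [hf]) }
  have hF : ∀ r, f r = r := fun r ↦ RingHom.congr_fun (Subsingleton.elim F (RingHom.id ℝ)) r
  exact AlgEquiv.exists_units_conj (AlgEquiv.ofRingEquiv (f := σ) fun r ↦ by rw [← hf, hF])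

end CentralSimple

/-! ### The adjoint representation and its kernel -/

/-- If every ring automorphism of `A` is inner, then every identification of `A` with a matrix ring
over a central `Z`-algebra identifies the automorphism group with the projective linear group. -/
theorem UnitsAndAutAreLinear.of_exists_units_conj {A : Type*} [Ring A] {Z : Type*} [Field Z]
    {K : Type*} [Ring K] [Algebra Z K] [Algebra.IsCentral Z K]
    (h : ∀ σ : RingAut A, ∃ g : Aˣ, ∀ q, σ q = g * q * (g⁻¹ : Aˣ)) :
    UnitsAndAutAreLinear A Z K := by
  intro m φ
  let e : Aˣ ≃* GLMat m K := Units.mapEquiv φ.toMulEquiv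
  let c : Aˣ →* RingAut A := (MulSemiringAction.toRingAut (ConjAct Aˣ) A).comp
    ConjAct.toConjAct.toMonoidHom
  have hc : ∀ u q, c u q = u * q * (u⁻¹ : Aˣ) := fun _ _ ↦ rfl
  let ψ : GLMat m K →* RingAut A := c.comp e.symm.toMonoidHom
  have hψ : Function.Surjective ψ := fun σ ↦ by
    obtain ⟨g, hg⟩ := h σ
    refine ⟨e g, RingEquiv.ext fun q ↦ ?_⟩
    rw [hg, ← hc]
    simp [ψ]
  have hker : ψ.ker = scalarGL Z m K := by
    ext M
    obtain ⟨u, rfl⟩ := e.surjective M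
    have h1 : e u ∈ ψ.ker ↔ ∀ N : Matrix (Fin m) (Fin m) K, N * e u = e u * N := by
      have h2 : e u ∈ ψ.ker ↔ ∀ q : A, q * u = u * q := by
        rw [MonoidHom.mem_ker, RingEquiv.ext_iff]
        refine forall_congr' fun q ↦ ?_
        have : ψ (e u) q = u * q * (u⁻¹ : Aˣ) := by simp [ψ, hc]
        rw [this, Units.mul_inv_eq_iff_eq_mul, eq_comm]
        rfl
      rw [h2, φ.surjective.forall]
      refine forall_congr' fun q ↦ ?_
      rw [← φ.injective.eq_iff, map_mul, map_mul]
      rfl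
    rw [h1, ← Subalgebra.mem_center_iff (R := Z), Algebra.IsCentral.mem_center_iff Z]
    constructor
    · rintro ⟨z, hz⟩
      -- The scalar 0 is a unit only in the zero ring (e.g. `m = 0`), where 1 serves instead.
      rcases eq_or_ne z 0 with rfl | hz0
      · have : Subsingleton (Matrix (Fin m) (Fin m) K) :=
          not_nontrivial_iff_subsingleton.1 fun _ ↦ (e u).ne_zero (by rw [hz, map_zero])
        exact ⟨1, Units.ext (Subsingleton.elim _ _)⟩
      · exact ⟨Units.mk0 z hz0, Units.ext hz.symm⟩
    · rintro ⟨z, hz⟩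
      exact ⟨z, by rw [← hz]; rfl⟩
  refine ⟨e, (QuotientGroup.quotientMulEquivOfEq hker.symm).trans
    (QuotientGroup.quotientKerEquivOfSurjective ψ hψ), fun _ ↦ rfl, fun u q ↦ ?_⟩
  change ψ (e u) q = _
  simp [ψ, hc]

/-- The center of the real quaternions is `ℝ`. -/
theorem Quaternion.isCentral_real : Algebra.IsCentral ℝ ℍ[ℝ] where
  out := fun q hq ↦ by
    have h (p : ℍ[ℝ]) : p * q = q * p := Subalgebra.mem_center_iff.1 hq p
    have hJ (p : ℍ[ℝ]) := congrArg (·.imJ) (h p)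
    have hK (p : ℍ[ℝ]) := congrArg (·.imK) (h p)
    simp only [Quaternion.imJ_mul, Quaternion.imK_mul] at hJ hK
    have h1 := hK ⟨0, 1, 0, 0⟩
    have h2 := hJ ⟨0, 1, 0, 0⟩
    have h3 := hK ⟨0, 0, 1, 0⟩
    simp only [zero_mul, mul_zero, one_mul, mul_one] at h1 h2 h3
    refine ⟨q.re, ?_⟩
    change (q.re : ℍ[ℝ]) = q
    ext <;> simp <;> linarith

/-! ### Splitting off a quaternion algebra -/

namespace CliffordAlgebra

variable {R M : Type*} [CommRing R] [AddCommGroup M] [Module R M]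

open CliffordAlgebraQuaternion (Q)

section

variable {a b c : R}

/-- The algebra homomorphism extending `(v, w) ↦ v ⊗ 1 + k ⊗ w`. -/
def prodToTensor (hc : c = -(a * b)) (Q' : QuadraticForm R M) :
    CliffordAlgebra ((Q a b).prod (c • Q')) →ₐ[R]
    ℍ[R,a,0,b] ⊗[R] CliffordAlgebra Q' :=
  CliffordAlgebra.lift _
    ⟨((Algebra.TensorProduct.includeLeft :
        ℍ[R,a,0,b] →ₐ[R] _ ⊗[R] CliffordAlgebra Q').toLinearMap ∘ₗ
        CliffordAlgebraQuaternion.toQuaternion.toLinearMap ∘ₗ ι (Q a b)).coprod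
      (TensorProduct.mk R _ _ (⟨0, 0, 0, 1⟩ : ℍ[R,a,0,b]) ∘ₗ ι Q'), fun v ↦ by
      have h1 : (⟨0, 0, 0, 1⟩ : ℍ[R,a,0,b]) * ⟨0, 0, 0, 1⟩ = algebraMap R _ (-(a * b)) := by
        ext <;> simp
      have h2 : (⟨0, v.1.1, v.1.2, 0⟩ : ℍ[R,a,0,b]) * ⟨0, v.1.1, v.1.2, 0⟩ =
          algebraMap R _ (Q a b v.1) := by
        ext <;> simp <;> ring
      have h3 : (⟨0, 0, 0, 1⟩ : ℍ[R,a,0,b]) * ⟨0, v.1.1, v.1.2, 0⟩ =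
          - (⟨0, v.1.1, v.1.2, 0⟩ * ⟨0, 0, 0, 1⟩) := by
        ext <;> simp
      have h4 : (⟨0, 0, 0, 1⟩ ⊗ₜ ι Q' v.2 * ⟨0, 0, 0, 1⟩ ⊗ₜ ι Q' v.2 :
          ℍ[R,a,0,b] ⊗[R] CliffordAlgebra Q') = algebraMap R _ (c * Q' v.2) := by
        rw [Algebra.TensorProduct.tmul_mul_tmul, h1, ι_sq_scalar, ← hc, map_mul,
          Algebra.TensorProduct.algebraMap_apply, Algebra.TensorProduct.algebraMap_apply',
          Algebra.TensorProduct.tmul_mul_tmul, one_mul, mul_one]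
      simp only [LinearMap.coprod_apply, LinearMap.comp_apply, TensorProduct.mk_apply,
        AlgHom.toLinearMap_apply, CliffordAlgebraQuaternion.toQuaternion_ι, add_mul, mul_add, h4,
        Algebra.TensorProduct.includeLeft_apply, Algebra.TensorProduct.tmul_mul_tmul, h2, h3,
        one_mul, mul_one, TensorProduct.neg_tmul]
      rw [QuadraticMap.prod_apply, _root_.smul_apply, smul_eq_mul, map_add,
        Algebra.TensorProduct.algebraMap_apply (Q a b v.1)]
      abel⟩

@[simp]
theorem prodToTensor_ι (hc : c = -(a * b)) (Q' : QuadraticForm R M) (v : (R × R) × M) :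
    prodToTensor hc Q' (ι _ v) =
      (⟨0, v.1.1, v.1.2, 0⟩ : ℍ[R,a,0,b]) ⊗ₜ 1 + ⟨0, 0, 0, 1⟩ ⊗ₜ ι Q' v.2 := by
  rw [prodToTensor, lift_ι_apply]
  simp

/-- The anticommuting elements `(1, 0)` and `(0, 1)` of the first summand. -/
def prodQuaternionBasis (a b c : R) (Q' : QuadraticForm R M) :
    QuaternionAlgebra.Basis (CliffordAlgebra ((Q a b).prod (c • Q'))) a 0 b :=
  (CliffordAlgebraQuaternion.quaternionBasis a b).compHom
    (CliffordAlgebra.map (QuadraticMap.Isometry.inl _ _))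

theorem prodQuaternionBasis_i (a b c : R) (Q' : QuadraticForm R M) :
    (prodQuaternionBasis a b c Q').i = ι _ ((1, 0), 0) := by
  simp [prodQuaternionBasis]

theorem prodQuaternionBasis_j (a b c : R) (Q' : QuadraticForm R M) :
    (prodQuaternionBasis a b c Q').j = ι _ ((0, 1), 0) := by
  simp [prodQuaternionBasis]

theorem prodQuaternionBasis_k (a b c : R) (Q' : QuadraticForm R M) :
    (prodQuaternionBasis a b c Q').k = ι _ ((1, 0), 0) * ι _ ((0, 1), 0) := by
  simp [prodQuaternionBasis]

theorem ι_inl_mul_ι_inr (a b c : R) (Q' : QuadraticForm R M) (v : R × R) (w : M) :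
    ι ((Q a b).prod (c • Q')) (v, 0) * ι _ (0, w) = - (ι _ (0, w) * ι _ (v, 0)) := by
  rw [eq_neg_iff_add_eq_zero, ι_mul_ι_add_swap, QuadraticMap.polar]
  simp

/-- The vector anticommutes with both factors of `k`, and the two signs cancel. -/
theorem prodQuaternionBasis_k_mul_ι_inr (a b c : R) (Q' : QuadraticForm R M) (w : M) :
    (prodQuaternionBasis a b c Q').k * ι _ (0, w) =
      ι _ (0, w) * (prodQuaternionBasis a b c Q').k := by
  rw [prodQuaternionBasis_k, mul_assoc, ι_inl_mul_ι_inr, mul_neg, ← mul_assoc, ι_inl_mul_ι_inr,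
    neg_mul, neg_neg, mul_assoc]

theorem prodQuaternionBasis_k_mul_k (a b c : R) (Q' : QuadraticForm R M) :
    (prodQuaternionBasis a b c Q').k * (prodQuaternionBasis a b c Q').k =
      algebraMap R _ (-(a * b)) := by
  rw [QuaternionAlgebra.Basis.k_mul_k, Algebra.algebraMap_eq_smul_one, neg_smul]

/-- The algebra homomorphism extending `w ↦ c k w`. Its image commutes with the first summand. -/
def prodOfRight (hc : c = -(a * b)) (h : c * c = 1) (Q' : QuadraticForm R M) :
    CliffordAlgebra Q' →ₐ[R] CliffordAlgebra ((Q a b).prod (c • Q')) :=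
  CliffordAlgebra.lift _
    -- Since k² = c and c² = 1, the factor ck is k⁻¹, which undoes the twist w ↦ k ⊗ w.
    ⟨(LinearMap.mulLeft R (c • (prodQuaternionBasis a b c Q').k)) ∘ₗ ι _ ∘ₗ
      LinearMap.inr R _ _, fun w ↦ by
      simp only [LinearMap.comp_apply, LinearMap.mulLeft_apply, LinearMap.inr_apply]
      rw [smul_mul_assoc, smul_mul_smul_comm]
      nth_rw 2 [prodQuaternionBasis_k_mul_ι_inr]
      rw [mul_assoc, ← mul_assoc (ι _ _), ι_sq_scalar, Algebra.commutes, ← mul_assoc,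
        prodQuaternionBasis_k_mul_k, Algebra.smul_def, ← map_mul, ← map_mul]
      congr 1
      simp
      linear_combination (c * c + 1) * Q' w * h - c * c * c * Q' w * hc⟩

@[simp]
theorem prodOfRight_ι (hc : c = -(a * b)) (h : c * c = 1) (Q' : QuadraticForm R M) (w : M) :
    prodOfRight hc h Q' (ι _ w) = c • (prodQuaternionBasis a b c Q').k * ι _ (0, w) := by
  simp [prodOfRight]

/-- The inverse of `CliffordAlgebra.prodToTensor`. -/
def tensorToProd (hc : c = -(a * b)) (h : c * c = 1) (Q' : QuadraticForm R M) :
    ℍ[R,a,0,b] ⊗[R] CliffordAlgebra Q' →ₐ[R]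
    CliffordAlgebra ((Q a b).prod (c • Q')) :=
  Algebra.TensorProduct.lift (prodQuaternionBasis a b c Q').liftHom (prodOfRight hc h Q')
    fun x y ↦ by
      set q := prodQuaternionBasis a b c Q'
      have hi : ∀ w, Commute q.i (q.k * ι _ (0, w)) := fun w ↦ by
        rw [commute_iff_eq, ← mul_assoc, QuaternionAlgebra.Basis.i_mul_k, mul_assoc,
          prodQuaternionBasis_i, ← neg_eq_iff_eq_neg.2 (ι_inl_mul_ι_inr a b c Q' (1, 0) w),
          mul_neg, ← mul_assoc, ← prodQuaternionBasis_i,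
          QuaternionAlgebra.Basis.k_mul_i]
        simp [q]
      have hj : ∀ w, Commute q.j (q.k * ι _ (0, w)) := fun w ↦ by
        rw [commute_iff_eq, ← mul_assoc, QuaternionAlgebra.Basis.j_mul_k, mul_assoc,
          prodQuaternionBasis_j, ← neg_eq_iff_eq_neg.2 (ι_inl_mul_ι_inr a b c Q' (0, 1) w),
          mul_neg, ← mul_assoc, ← prodQuaternionBasis_j,
          QuaternionAlgebra.Basis.k_mul_j]
        simp [q]
      have hk : ∀ w, Commute q.k (q.k * ι _ (0, w)) := fun w ↦
        (Commute.refl _).mul_right (prodQuaternionBasis_k_mul_ι_inr a b c Q' w)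
      induction y using CliffordAlgebra.induction with
      | algebraMap r => rw [AlgHom.commutes]; exact Algebra.commute_algebraMap_right _ _
      | ι w =>
        rw [prodOfRight_ι, smul_mul_assoc]
        refine Commute.smul_right ?_ c
        exact (((Algebra.commute_algebraMap_left _ _).add_left ((hi w).smul_left _)).add_left
          ((hj w).smul_left _)).add_left ((hk w).smul_left _)
      | mul y z hy hz => rw [map_mul]; exact hy.mul_right hz
      | add y z hy hz => rw [map_add]; exact hy.add_right hz

/-- For `c = -ab = ±1`, the Clifford algebra of the orthogonal sum of `a x² + b y²` and `c Q'` is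
the tensor product of a quaternion algebra with the Clifford algebra of `Q'`. -/
def prodEquivTensor (hc : c = -(a * b)) (h : c * c = 1) (Q' : QuadraticForm R M) :
    CliffordAlgebra ((Q a b).prod (c • Q')) ≃ₐ[R] ℍ[R,a,0,b] ⊗[R] CliffordAlgebra Q' :=
  AlgEquiv.ofAlgHom (prodToTensor hc Q') (tensorToProd hc h Q')
    (by
      ext
      · simp [tensorToProd, QuaternionAlgebra.Basis.lift, prodQuaternionBasis_i]
      · simp [tensorToProd, QuaternionAlgebra.Basis.lift, prodQuaternionBasis_j]
      · simp [tensorToProd, QuaternionAlgebra.Basis.lift, prodQuaternionBasis_k]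
        have h0 : (⟨0, 0, 0, 0⟩ : ℍ[R,a,0,b]) = 0 := rfl
        have h1 : (⟨0, 0, 0, 1⟩ : ℍ[R,a,0,b]) * ⟨0, 0, 0, 1⟩ = algebraMap R _ c := by
          ext <;> simp [hc]
        rw [h0, TensorProduct.zero_tmul, zero_add, Algebra.TensorProduct.tmul_mul_tmul, one_mul, h1,
          TensorProduct.smul_tmul', Algebra.smul_def, ← map_mul, h,
          map_one])
    (by
      ext
      · simp [tensorToProd, QuaternionAlgebra.Basis.lift, prodQuaternionBasis_i]
      · simp [tensorToProd, QuaternionAlgebra.Basis.lift, prodQuaternionBasis_j]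
      · simp [tensorToProd, QuaternionAlgebra.Basis.lift]
        rw [← mul_assoc, prodQuaternionBasis_k_mul_k, ← Algebra.smul_def, smul_smul, ← hc, h,
          one_smul])

end

end CliffordAlgebra

/-! ### Real and quaternionic matrix algebras -/

section

open Matrix

variable {A B : Type*} [Ring A] [Ring B] [Algebra ℝ A] [Algebra ℝ B]

/-- The property of being isomorphic to a real or quaternionic matrix algebra. -/
def IsRealOrQuaternionicMatrixAlgebra (A : Type*) [Ring A] [Algebra ℝ A] : Prop :=
  (∃ m : ℕ, Nonempty (A ≃ₐ[ℝ] Matrix (Fin m) (Fin m) ℝ)) ∨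
    (∃ m : ℕ, Nonempty (A ≃ₐ[ℝ] Matrix (Fin m) (Fin m) ℍ[ℝ]))

namespace IsRealOrQuaternionicMatrixAlgebra

theorem of_algEquiv (e : A ≃ₐ[ℝ] B) (h : IsRealOrQuaternionicMatrixAlgebra B) :
    IsRealOrQuaternionicMatrixAlgebra A :=
  h.imp (fun ⟨m, ⟨f⟩⟩ ↦ ⟨m, ⟨e.trans f⟩⟩) (fun ⟨m, ⟨f⟩⟩ ↦ ⟨m, ⟨e.trans f⟩⟩)

theorem matrix_real (n : Type*) [Fintype n] [DecidableEq n] :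
    IsRealOrQuaternionicMatrixAlgebra (Matrix n n ℝ) :=
  .inl ⟨_, ⟨reindexAlgEquiv ℝ ℝ (Fintype.equivFin n)⟩⟩

theorem matrix_quaternion (n : Type*) [Fintype n] [DecidableEq n] :
    IsRealOrQuaternionicMatrixAlgebra (Matrix n n ℍ[ℝ]) :=
  .inr ⟨_, ⟨reindexAlgEquiv ℝ ℍ[ℝ] (Fintype.equivFin n)⟩⟩

theorem matrix_tensor (n : Type) [Fintype n] [DecidableEq n]
    (h : IsRealOrQuaternionicMatrixAlgebra B) :
    IsRealOrQuaternionicMatrixAlgebra (Matrix n n ℝ ⊗[ℝ] B) := by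
  obtain ⟨m, ⟨f⟩⟩ | ⟨m, ⟨f⟩⟩ := h
  · exact of_algEquiv ((Algebra.TensorProduct.congr .refl f).trans
      (kroneckerAlgEquiv n (Fin m) ℝ)) (matrix_real _)
  · exact of_algEquiv ((Algebra.TensorProduct.congr .refl f).trans
      ((kroneckerTMulAlgEquiv n (Fin m) ℝ ℝ ℝ ℍ[ℝ]).trans
        (Algebra.TensorProduct.lid ℝ ℍ[ℝ]).mapMatrix)) (matrix_quaternion _)

/-- `ℍ ⊗ ℍ ≅ Mat(4, ℝ)`. -/
theorem _root_.Quaternion.nonempty_tensor_algEquiv_matrix :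
    Nonempty (ℍ[ℝ] ⊗[ℝ] ℍ[ℝ] ≃ₐ[ℝ] Matrix (Fin 4) (Fin 4) ℝ) := by
  have := Quaternion.isCentral_real
  have := IsAzumaya.of_isSimpleRing ℝ ℍ[ℝ]
  -- Conjugation identifies ℍ with its opposite, and ℍ ⊗ ℍᵒᵖ ≅ End(ℍ).
  exact ⟨(Algebra.TensorProduct.congr .refl Quaternion.starAe).trans
    ((AlgEquiv.ofBijective _ (IsAzumaya.bij (R := ℝ) (A := ℍ[ℝ]))).trans
      (algEquivMatrix (QuaternionAlgebra.basisOneIJK (-1 : ℝ) 0 (-1))))⟩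

theorem quaternion_tensor (h : IsRealOrQuaternionicMatrixAlgebra B) :
    IsRealOrQuaternionicMatrixAlgebra (ℍ[ℝ] ⊗[ℝ] B) := by
  obtain ⟨m, ⟨f⟩⟩ | ⟨m, ⟨f⟩⟩ := h
  · exact of_algEquiv ((Algebra.TensorProduct.congr .refl f).trans
      (matrixEquivTensor (Fin m) ℝ ℍ[ℝ]).symm) (matrix_quaternion _)
  · obtain ⟨g⟩ := Quaternion.nonempty_tensor_algEquiv_matrix
    exact of_algEquiv ((Algebra.TensorProduct.congr .refl
      (f.trans (matrixEquivTensor (Fin m) ℝ ℍ[ℝ]))).trans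
      ((Algebra.TensorProduct.assoc ℝ ℝ ℝ ℍ[ℝ] ℍ[ℝ] (Matrix (Fin m) (Fin m) ℝ)).symm.trans
        ((Algebra.TensorProduct.congr g .refl).trans (kroneckerAlgEquiv (Fin 4) (Fin m) ℝ))))
      (matrix_real _)

end IsRealOrQuaternionicMatrixAlgebra

/-- The quaternion algebra with `i² = 1` and `j² = b` splits. -/
theorem QuaternionAlgebra.nonempty_algEquiv_matrix_one {b : ℝ} (hb : b ≠ 0) :
    Nonempty (ℍ[ℝ,1,0,b] ≃ₐ[ℝ] Matrix (Fin 2) (Fin 2) ℝ) := by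
  let q : QuaternionAlgebra.Basis (Matrix (Fin 2) (Fin 2) ℝ) 1 0 b :=
    { i := !![1, 0; 0, -1]
      j := !![0, b; 1, 0]
      k := !![0, b; -1, 0]
      i_mul_i := by ext i j; fin_cases i <;> fin_cases j <;> simp
      j_mul_j := by ext i j; fin_cases i <;> fin_cases j <;> simp
      i_mul_j := by ext i j; fin_cases i <;> fin_cases j <;> simp
      j_mul_i := by ext i j; fin_cases i <;> fin_cases j <;> simp }
  have hinj : Function.Injective q.liftHom.toLinearMap := by
    rw [← LinearMap.ker_eq_bot, LinearMap.ker_eq_bot']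
    intro x hx
    have h i j := congrFun (congrFun hx i) j
    have h1 := h 0 0
    have h2 := h 0 1
    have h3 := h 1 0
    have h4 := h 1 1
    simp [QuaternionAlgebra.Basis.lift, q, algebraMap_matrix_apply] at h1 h2 h3 h4
    have h5 : x.imJ + x.imK = 0 := by
      rw [← add_mul] at h2
      exact (mul_eq_zero.1 h2).resolve_right hb
    ext <;> simp <;> linarith
  refine ⟨AlgEquiv.ofBijective q.liftHom
    ⟨hinj, (LinearMap.injective_iff_surjective_of_finrank_eq_finrank ?_).1 hinj⟩⟩
  rw [QuaternionAlgebra.finrank_eq_four, Module.finrank_matrix, Module.finrank_self]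
  rfl

namespace IsRealOrQuaternionicMatrixAlgebra

/-- Only a = b = -1 gives ℍ; otherwise a generator squares to 1 and the quaternion algebra splits,
after swapping generators if needed. -/
theorem quaternionAlgebra_tensor {a b : ℝ} (ha : a = -1 ∨ a = 1) (hb : b = -1 ∨ b = 1)
    (h : IsRealOrQuaternionicMatrixAlgebra B) :
    IsRealOrQuaternionicMatrixAlgebra (ℍ[ℝ,a,0,b] ⊗[ℝ] B) := by
  have hb0 : b ≠ 0 := by rcases hb with rfl | rfl <;> norm_num
  rcases ha with rfl | rfl
  · rcases hb with rfl | rfl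
    · exact quaternion_tensor h
    · obtain ⟨g⟩ := QuaternionAlgebra.nonempty_algEquiv_matrix_one (neg_ne_zero.2 hb0)
      exact of_algEquiv (Algebra.TensorProduct.congr ((QuaternionAlgebra.swapEquiv _ _).trans g)
        .refl) (matrix_tensor _ h)
  · obtain ⟨g⟩ := QuaternionAlgebra.nonempty_algEquiv_matrix_one hb0
    exact of_algEquiv (Algebra.TensorProduct.congr g .refl) (matrix_tensor _ h)

open QuadraticMap

/-- Splitting off the first two squares from a weighted sum of squares with weights `± 1`. -/
def _root_.QuadraticForm.weightedSumSquaresIsometryEquivProd {m : ℕ} (w : Fin (m + 2) → ℝ) {c : ℝ}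
    (hc : c * c = 1) :
    (weightedSumSquares ℝ w).IsometryEquiv
      ((CliffordAlgebraQuaternion.Q (w 0) (w 1)).prod
        (c • weightedSumSquares ℝ fun i : Fin m ↦ c * w i.succ.succ)) where
  toFun v := ((v 0, v 1), fun i ↦ v i.succ.succ)
  invFun p := Matrix.vecCons p.1.1 (Matrix.vecCons p.1.2 p.2)
  map_add' _ _ := rfl
  map_smul' _ _ := rfl
  left_inv v := by
    ext i
    refine Fin.cases rfl (fun i ↦ Fin.cases rfl (fun i ↦ rfl) i) i
  right_inv _ := rfl
  map_app' v := by
    simp only [prod_apply, CliffordAlgebraQuaternion.Q_apply, _root_.smul_apply,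
      weightedSumSquares_apply, Fin.sum_univ_succ, smul_eq_mul, Finset.mul_sum, add_assoc]
    congr 2
    refine Finset.sum_congr rfl fun i _ ↦ ?_
    -- The remaining weights carry a factor `c`, cancelled by the outer `c`.
    linear_combination (w i.succ.succ * v i.succ.succ * v i.succ.succ) * hc

/-- Each step of the induction multiplies the remaining weights by c = ±1, so all sign patterns are
treated together. -/
theorem cliffordAlgebra_weightedSumSquares {N : ℕ} (hN : Even N) (w : Fin N → ℝ)
    (hw : ∀ i, w i = -1 ∨ w i = 1) :
    IsRealOrQuaternionicMatrixAlgebra (CliffordAlgebra (weightedSumSquares ℝ w)) := by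
  obtain ⟨n, hn⟩ := hN
  induction n generalizing N with
  | zero =>
    obtain rfl : N = 0 := hn
    have e : (weightedSumSquares ℝ w).IsometryEquiv (0 : QuadraticForm ℝ Unit) :=
      { (0 : (Fin 0 → ℝ) ≃ₗ[ℝ] Unit) with
        map_app' := fun v ↦ by simp [weightedSumSquares_apply] }
    refine of_algEquiv ((CliffordAlgebra.equivOfIsometry e).trans CliffordAlgebraRing.equiv)
      (of_algEquiv (AlgEquiv.ofBijective (Algebra.ofId ℝ (Matrix (Fin 1) (Fin 1) ℝ))
        ⟨FaithfulSMul.algebraMap_injective _ _, fun M ↦ ⟨M 0 0, ?_⟩⟩) (matrix_real (Fin 1)))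
    ext i j
    rw [Subsingleton.elim i 0, Subsingleton.elim j 0]
    simp [Algebra.ofId_apply, algebraMap_matrix_apply]
  | succ n ih =>
    obtain rfl : N = n + n + 2 := by omega
    have hc : (-(w 0 * w 1)) * (-(w 0 * w 1)) = 1 := by
      rcases hw 0 with h0 | h0 <;> rcases hw 1 with h1 | h1 <;> norm_num [h0, h1]
    refine of_algEquiv ((CliffordAlgebra.equivOfIsometry
      (QuadraticForm.weightedSumSquaresIsometryEquivProd w hc)).trans
        (CliffordAlgebra.prodEquivTensor rfl hc _)) (quaternionAlgebra_tensor (hw 0) (hw 1)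
          (ih _ (fun i ↦ ?_) rfl))
    rcases hw 0 with h0 | h0 <;> rcases hw 1 with h1 | h1 <;>
      rcases hw i.succ.succ with h2 | h2 <;> norm_num [h0, h1, h2]

end IsRealOrQuaternionicMatrixAlgebra

end

/-! ### Conclusion for real Clifford algebras -/

/-- The real Clifford algebra of a non-degenerate form in even dimension is a real or quaternionic
matrix algebra. -/
theorem RealClifford.isRealOrQuaternionicMatrixAlgebra {V : Type*} [AddCommGroup V] [Module ℝ V]
    [FiniteDimensional ℝ V] (η : LinearMap.BilinForm ℝ V) (hsymm : η.IsSymm) (hη : η.Nondegenerate)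
    (heven : Even (Module.finrank ℝ V)) : IsRealOrQuaternionicMatrixAlgebra (RealClifford η) := by
  have hQ : QuadraticMap.associated (R := ℝ) (LinearMap.BilinMap.toQuadraticMap η) = η :=
    QuadraticMap.associated_left_inverse ℝ hsymm.eq
  obtain ⟨w, hw, ⟨e⟩⟩ := QuadraticForm.equivalent_one_neg_one_weighted_sum_squared
    (LinearMap.BilinMap.toQuadraticMap η) (by rw [hQ]; exact hη.1)
  exact .of_algEquiv (CliffordAlgebra.equivOfIsometry e)
    (.cliffordAlgebra_weightedSumSquares heven w hw)

/-- Every ring automorphism of a real or quaternionic matrix algebra is inner. -/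
theorem IsRealOrQuaternionicMatrixAlgebra.exists_units_conj {A : Type*} [Ring A] [Nontrivial A]
    [Algebra ℝ A] (h : IsRealOrQuaternionicMatrixAlgebra A) (σ : RingAut A) :
    ∃ g : Aˣ, ∀ q, σ q = g * q * (g⁻¹ : Aˣ) := by
  have := Quaternion.isCentral_real
  have key {B : Type} [Ring B] [Algebra ℝ B] [FiniteDimensional ℝ B] [Algebra.IsCentral ℝ B]
      [IsSimpleRing B] {m : ℕ} (f : A ≃ₐ[ℝ] Matrix (Fin m) (Fin m) B) :
      ∃ g : Aˣ, ∀ q, σ q = g * q * (g⁻¹ : Aˣ) := by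
    -- Simplicity of the matrix ring needs m > 0.
    have : Nonempty (Fin m) := by
      by_contra hm
      rw [not_nonempty_iff] at hm
      exact not_subsingleton A f.injective.subsingleton
    let τ : RingAut (Matrix (Fin m) (Fin m) B) :=
      (f.symm.toRingEquiv.trans σ).trans f.toRingEquiv
    obtain ⟨g, hg⟩ := τ.exists_units_conj_of_isCentral_real
    refine ⟨Units.map f.symm.toMonoidHom g, fun q ↦ f.injective ?_⟩
    have hτ : f (σ q) = τ (f q) := by simp [τ]
    rw [hτ, hg, map_mul, map_mul, ← map_inv]
    simp
  obtain ⟨m, ⟨f⟩⟩ | ⟨m, ⟨f⟩⟩ := h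
  exacts [key f, key f]

theorem mainTheorem3 {V : Type*} [AddCommGroup V] [Module ℝ V] [FiniteDimensional ℝ V]
    (η : LinearMap.BilinForm ℝ V) (hsymm : η.IsSymm) (hη : η.Nondegenerate)
    (heven : Even (Module.finrank ℝ V)) :
    (∀ σ : RingAut (RealClifford η), ∃ g : (RealClifford η)ˣ, ∀ q : RealClifford η,
      σ q = (g : RealClifford η) * q * ((g⁻¹ : (RealClifford η)ˣ) : RealClifford η)) ∧
    ((∃ m : ℕ, Nonempty (RealClifford η ≃ₐ[ℝ] Matrix (Fin m) (Fin m) ℝ)) ∨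
      (∃ m : ℕ, Nonempty (RealClifford η ≃ₐ[ℝ] Matrix (Fin m) (Fin m) ℍ[ℝ]))) ∧
    UnitsAndAutAreLinear (RealClifford η) ℝ ℝ ∧
    UnitsAndAutAreLinear (RealClifford η) ℂ ℂ ∧
    UnitsAndAutAreLinear (RealClifford η) ℝ ℍ[ℝ] := by
  have h := RealClifford.isRealOrQuaternionicMatrixAlgebra η hsymm hη heven
  have hinner := h.exists_units_conj
  have := Quaternion.isCentral_real
  exact ⟨hinner, h, .of_exists_units_conj hinner, .of_exists_units_conj hinner,
    .of_exists_units_conj hinner⟩
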